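/- Let $\rho=\begin{pmatrix}A&B\\ B^*&C\end{pmatrix}$ be a density matrix (complex, finite-dimensional, positive semidefinite, of trace one; $\rho$ need not be invertible) whose square diagonal blocks $A$ and $C$ are positive definite, and let $\Pi\rho=\begin{pmatrix}A&0\\ 0&C\end{pmatrix}$ be its block-diagonal pinching. Then the integral $$\Omega_{A,C}^{-1}(B)=\int_0^\infty (A+rI)^{-1}B\,(C+rI)^{-1}\,dr$$ converges absolutely (entry by entry), and $$D(\rho\|\Pi\rho)\;\ge\;\operatorname{Tr}\bigl[B^*\,\Omega_{A,C}^{-1}(B)\bigr].$$ Here $D(\rho\|\sigma)=\operatorname{Tr}[\rho(\log\rho-\log\sigma)]$ if $\ker\sigma\subseteq\ker\rho$ and $D(\rho\|\sigma)=+\infty$ otherwise, with natural logarithms and $0\log 0=0$. -/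

import Mathlib

open scoped Matrix ComplexOrder

noncomputable section

namespace BlockEntropy

/-- A density matrix: positive semidefinite (in particular Hermitian) with trace one. -/
def IsDensityMatrix {d : Type*} [Fintype d] (ρ : Matrix d d ℂ) : Prop :=
  ρ.PosSemidef ∧ ρ.trace = 1

/-- The logarithm of a Hermitian matrix by functional calculus. Since `Real.log 0 = 0`, it
vanishes on the kernel, so that `ρ * matLog ρ` follows the convention `0 log 0 = 0`. -/
def matLog {d : Type*} [Fintype d] [DecidableEq d] (ρ : Matrix d d ℂ) : Matrix d d ℂ :=
  cfc Real.log ρ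

open Classical in
/-- The Umegaki relative entropy `D(ρ‖σ)` of positive semidefinite matrices: it is
`Tr[ρ (log ρ - log σ)]` (a real number, since `ρ` and the logarithms are Hermitian) if
`ker σ ⊆ ker ρ`, that is `supp ρ ⊆ supp σ`, and `+∞` otherwise. -/
def relEntropy {d : Type*} [Fintype d] [DecidableEq d] (ρ σ : Matrix d d ℂ) : EReal :=
  if ∀ v : d → ℂ, σ *ᵥ v = 0 → ρ *ᵥ v = 0 then
    (((ρ * (matLog ρ - matLog σ)).trace.re : ℝ) : EReal)
  else ⊤

/-- The block-diagonal pinching: it keeps the two diagonal blocks of a matrix and replaces the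
off-diagonal blocks by zero. -/
def pinching {m n : Type*} (ρ : Matrix (m ⊕ n) (m ⊕ n) ℂ) : Matrix (m ⊕ n) (m ⊕ n) ℂ :=
  Matrix.fromBlocks ρ.toBlocks₁₁ 0 0 ρ.toBlocks₂₂

/-- The integrand `(A + r I)⁻¹ B (C + r I)⁻¹` of the Bogoliubov-Kubo-Mori kernel. -/
def bkmIntegrand {m n : Type*} [Fintype m] [Fintype n] [DecidableEq m] [DecidableEq n]
    (A : Matrix m m ℂ) (C : Matrix n n ℂ) (B : Matrix m n ℂ) (r : ℝ) : Matrix m n ℂ :=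
  (A + (r : ℂ) • (1 : Matrix m m ℂ))⁻¹ * B * (C + (r : ℂ) • (1 : Matrix n n ℂ))⁻¹

/-- The Bogoliubov-Kubo-Mori kernel `∫₀^∞ (A + r I)⁻¹ B (C + r I)⁻¹ dr`, the integral of a
matrix-valued function being taken entry by entry. -/
def bkmKernel {m n : Type*} [Fintype m] [Fintype n] [DecidableEq m] [DecidableEq n]
    (A : Matrix m m ℂ) (C : Matrix n n ℂ) (B : Matrix m n ℂ) : Matrix m n ℂ :=
  Matrix.of fun i j => ∫ r in Set.Ioi (0 : ℝ), bkmIntegrand A C B r i j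

end BlockEntropy

end

open MeasureTheory Filter Topology Set

namespace BlockEntropy

/-! Write σ for the pinching of ρ. Since log σ is block diagonal, D(ρ‖σ) = Tr ρ log ρ − Tr σ log σ,
and, the traces being equal, this is the integral over r > 0 of log det(σ + r) − log det(ρ + r). It
therefore suffices to bound this integrand below by Tr[B* (A + r)⁻¹ B (C + r)⁻¹] for each r > 0
(`trace_mul_bkmIntegrand_le`). The shift makes ρ + r positive definite, so ρ itself may be singular.

For a positive definite block matrix, the difference of log determinants is log det C − log det M
with M = C − B* A⁻¹ B the Schur complement. Applying log x ≤ x − 1 to the spectrum of M C⁻¹ gives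
the bound (`trace_le_log_det_sub`). -/

theorem posDef_add_smul_one {d : Type*} [DecidableEq d] {A : Matrix d d ℂ} (hA : A.PosSemidef) {r : ℝ}
    (hr : 0 < r) :
    (A + (r : ℂ) • (1 : Matrix d d ℂ)).PosDef :=
  Matrix.PosDef.posSemidef_add hA (Matrix.PosDef.one.smul (by exact_mod_cast hr))

variable {m n d : Type*} [Fintype d] [DecidableEq m] [DecidableEq n]

theorem fromBlocks_add_smul_one (A : Matrix m m ℂ) (B : Matrix m n ℂ) (B' : Matrix n m ℂ)
    (C : Matrix n n ℂ) (z : ℂ) :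
    Matrix.fromBlocks A B B' C + z • (1 : Matrix (m ⊕ n) (m ⊕ n) ℂ)
      = Matrix.fromBlocks (A + z • 1) B B' (C + z • 1) := by
  rw [← Matrix.fromBlocks_one, Matrix.fromBlocks_smul, Matrix.fromBlocks_add]
  simp

/-! ### Scalar asymptotics and integrals of logarithms -/

theorem tendsto_add_mul_log_sub {x : ℝ} (hx : 0 ≤ x) :
    Tendsto (fun R : ℝ => (x + R) * Real.log (x + R) - (x + R) * Real.log R) atTop (𝓝 x) := by
  have h1 := Real.tendsto_mul_log_one_add_div_atTop x
  have h2 : Tendsto (fun R : ℝ => x * Real.log (1 + x / R)) atTop (𝓝 0) := by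
    have h3 : Tendsto (fun R : ℝ => 1 + x / R) atTop (𝓝 1) := by
      simpa using (tendsto_const_nhds (x := x)).div_atTop tendsto_id |>.const_add 1
    simpa using (h3.log one_ne_zero).const_mul x
  have h4 := h2.add h1
  rw [zero_add] at h4
  refine h4.congr' ?_
  filter_upwards [eventually_gt_atTop 0] with R hR
  have : 1 + x / R = (x + R) / R := by field_simp; ring
  rw [this, Real.log_div (by positivity) hR.ne']
  ring

/-- Both families have the same cardinality and sum, so the divergent terms (x + R) log R cancel, as
do the limits ∑ a and ∑ b. -/
theorem tendsto_sum_add_mul_log_sub {a b : d → ℝ} (ha : ∀ i, 0 ≤ a i) (hb : ∀ i, 0 ≤ b i)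
    (hab : ∑ i, a i = ∑ i, b i) :
    Tendsto (fun R : ℝ => ∑ i, (a i + R) * Real.log (a i + R)
      - ∑ i, (b i + R) * Real.log (b i + R)) atTop (𝓝 0) := by
  have h := (tendsto_finsetSum Finset.univ fun i _ => tendsto_add_mul_log_sub (ha i)).sub
    (tendsto_finsetSum Finset.univ fun i _ => tendsto_add_mul_log_sub (hb i))
  rw [hab, sub_self] at h
  refine h.congr fun R => ?_
  simp only [Finset.sum_sub_distrib, ← Finset.sum_mul, Finset.sum_add_distrib, hab]
  ring

theorem integral_log_add (x R : ℝ) :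
    ∫ r in (0 : ℝ)..R, Real.log (x + r) = (x + R) * Real.log (x + R) - x * Real.log x - R := by
  rw [intervalIntegral.integral_comp_add_left (fun s => Real.log s), integral_log, add_zero]
  ring

/-- The singularity of log at 0, met when x = 0 (a singular ρ), is integrable. -/
theorem intervalIntegrable_log_add (x R : ℝ) :
    IntervalIntegrable (fun r => Real.log (x + r)) volume 0 R := by
  have h : IntervalIntegrable Real.log volume (x + 0) (x + R) :=
    intervalIntegral.intervalIntegrable_log'
  simpa using h.comp_add_left x

theorem integral_le_sum_mul_log_sub {a b : d → ℝ} (ha : ∀ i, 0 ≤ a i) (hb : ∀ i, 0 ≤ b i)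
    (hab : ∑ i, a i = ∑ i, b i) {g : ℝ → ℝ} (hg : IntegrableOn g (Ioi 0))
    (hle : ∀ r, 0 < r → g r ≤ ∑ i, Real.log (a i + r) - ∑ i, Real.log (b i + r)) :
    ∫ r in Ioi (0 : ℝ), g r
      ≤ ∑ i, b i * Real.log (b i) - ∑ i, a i * Real.log (a i) := by
  have h1 := intervalIntegral_tendsto_integral_Ioi 0 hg tendsto_id
  have h2 := (tendsto_sum_add_mul_log_sub ha hb hab).add_const
    (∑ i, b i * Real.log (b i) - ∑ i, a i * Real.log (a i))
  rw [zero_add] at h2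
  refine le_of_tendsto_of_tendsto h1 h2 ?_
  filter_upwards [eventually_ge_atTop 0] with R hR
  have hia (c : d → ℝ) : IntervalIntegrable (fun r => ∑ i, Real.log (c i + r)) volume 0 R := by
    have := IntervalIntegrable.sum (μ := volume) (a := 0) (b := R) Finset.univ
      (f := fun i r => Real.log (c i + r)) fun i _ => intervalIntegrable_log_add (c i) R
    simpa [Finset.sum_fn] using this
  calc ∫ r in (0 : ℝ)..R, g r
      ≤ ∫ r in (0 : ℝ)..R, (∑ i, Real.log (a i + r) - ∑ i, Real.log (b i + r)) := by
        -- The open interval suffices; the bound is not available at r = 0.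
        refine intervalIntegral.integral_mono_on_of_le_Ioo hR ?_ ((hia a).sub (hia b))
          fun r hr => hle r hr.1
        exact (intervalIntegrable_iff_integrableOn_Ioc_of_le hR).2 (hg.mono_set Ioc_subset_Ioi_self)
    _ = _ := by
        rw [intervalIntegral.integral_sub (hia a) (hia b),
          intervalIntegral.integral_finsetSum fun i _ => intervalIntegrable_log_add (a i) R,
          intervalIntegral.integral_finsetSum fun i _ => intervalIntegrable_log_add (b i) R]
        simp only [integral_log_add, Finset.sum_sub_distrib]
        ring

/-! ### Spectral formulas and determinant inequalities -/

variable [Fintype m] [Fintype n] [DecidableEq d]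

theorem det_add_smul_one {ρ : Matrix d d ℂ} (hρ : ρ.IsHermitian) (r : ℝ) :
    (ρ + (r : ℂ) • (1 : Matrix d d ℂ)).det = ((∏ i, (hρ.eigenvalues i + r) : ℝ) : ℂ) := by
  -- The determinant is, up to sign, the characteristic polynomial at −r.
  have h := ρ.eval_charpoly (-(r : ℂ))
  rw [hρ.charpoly_eq, Polynomial.eval_prod] at h
  have h2 : Matrix.scalar d (-(r : ℂ)) - ρ = -(ρ + (r : ℂ) • (1 : Matrix d d ℂ)) := by
    rw [Matrix.scalar_apply, ← Matrix.smul_one_eq_diagonal, neg_smul]; abel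
  rw [h2, Matrix.det_neg] at h
  have h3 : ∀ i, Polynomial.eval (-(r : ℂ)) (Polynomial.X - Polynomial.C (hρ.eigenvalues i : ℂ))
      = (-1) * ((hρ.eigenvalues i + r : ℝ) : ℂ) := by
    intro i; simp; ring
  simp only [RCLike.ofReal_eq_complex_ofReal, h3] at h
  rw [Finset.prod_mul_distrib, Finset.prod_const, Finset.card_univ] at h
  rw [Complex.ofReal_prod]
  exact (mul_left_cancel₀ (pow_ne_zero _ (by norm_num)) h).symm

theorem trace_mul_matLog {ρ : Matrix d d ℂ} (hρ : ρ.IsHermitian) :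
    (ρ * matLog ρ).trace = ((∑ i, hρ.eigenvalues i * Real.log (hρ.eigenvalues i) : ℝ) : ℂ) := by
  have h : ρ * matLog ρ = Unitary.conjStarAlgAut ℂ _ hρ.eigenvectorUnitary
      (Matrix.diagonal fun i =>
        ((hρ.eigenvalues i * Real.log (hρ.eigenvalues i) : ℝ) : ℂ)) := by
    rw [matLog, hρ.cfc_eq, Matrix.IsHermitian.cfc]
    nth_rw 1 [hρ.spectral_theorem]
    rw [← map_mul, Matrix.diagonal_mul_diagonal]
    simp
  rw [h, Unitary.conjStarAlgAut_apply, Matrix.trace_mul_cycle, Unitary.coe_star_mul_self, one_mul,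
    Matrix.trace_diagonal, Complex.ofReal_sum]

theorem log_det_le_trace_sub_card {N : Matrix n n ℂ} (hN : N.PosDef) :
    Real.log N.det.re ≤ N.trace.re - Fintype.card n := by
  have h1 := hN.isHermitian.det_eq_prod_eigenvalues
  have h2 := hN.isHermitian.trace_eq_sum_eigenvalues
  simp only [RCLike.ofReal_eq_complex_ofReal] at h1 h2
  rw [h1, h2, ← Complex.ofReal_prod, ← Complex.ofReal_sum, Complex.ofReal_re, Complex.ofReal_re,
    Real.log_prod fun i _ => (hN.eigenvalues_pos i).ne']
  calc _ ≤ ∑ i, (hN.isHermitian.eigenvalues i - 1) :=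
        Finset.sum_le_sum fun i _ => Real.log_le_sub_one_of_pos (hN.eigenvalues_pos i)
    _ = _ := by simp

open scoped MatrixOrder in
theorem exists_conjTranspose_mul_self {C : Matrix n n ℂ} (hC : C.PosSemidef) :
    ∃ Y : Matrix n n ℂ, C = Yᴴ * Y :=
  CStarAlgebra.nonneg_iff_eq_star_mul_self.mp hC.nonneg

theorem det_re_pos {C : Matrix n n ℂ} (hC : C.PosDef) : 0 < C.det.re ∧ C.det = (C.det.re : ℂ) := by
  have h := Complex.lt_def.1 hC.det_pos
  exact ⟨h.1, Complex.ext rfl (by simpa using h.2.symm)⟩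

/-- M C⁻¹ need not be Hermitian. With C⁻¹ = Y* Y, the matrix Y M Y* is positive definite and has the
same trace and determinant. -/
theorem log_det_le {M C : Matrix n n ℂ} (hM : M.PosDef) (hC : C.PosDef) :
    Real.log M.det.re ≤ Real.log C.det.re + (M * C⁻¹).trace.re - Fintype.card n := by
  obtain ⟨Y, hY⟩ := exists_conjTranspose_mul_self hC.inv.posSemidef
  have hYu : IsUnit Y := by
    have h := hC.inv.isUnit
    rw [hY] at h
    exact isUnit_of_mul_isUnit_right h
  have hN : (Y * M * Yᴴ).PosDef := by
    have := (Matrix.IsUnit.posDef_star_right_conjugate_iff (x := M) hYu).2 hM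
    simpa [Matrix.star_eq_conjTranspose] using this
  have h := log_det_le_trace_sub_card hN
  have hdet : (Y * M * Yᴴ).det = C⁻¹.det * M.det := by
    rw [hY]; simp only [Matrix.det_mul]; ring
  have htr : (Y * M * Yᴴ).trace = (M * C⁻¹).trace := by
    rw [hY, Matrix.trace_mul_cycle, Matrix.trace_mul_comm]
  have hC1 : C⁻¹.det = ((C.det.re⁻¹ : ℝ) : ℂ) := by
    rw [Matrix.det_nonsing_inv, Ring.inverse_eq_inv', (det_re_pos hC).2]; simp
  rw [hdet, htr, hC1, Complex.re_ofReal_mul, Real.log_mul (inv_ne_zero (det_re_pos hC).1.ne')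
    (det_re_pos hM).1.ne', Real.log_inv] at h
  linarith

theorem trace_le_log_det_sub {A : Matrix m m ℂ} {B : Matrix m n ℂ} {C : Matrix n n ℂ}
    (hA : A.PosDef) (hC : C.PosDef) (hρ : (Matrix.fromBlocks A B Bᴴ C).PosDef) :
    (Bᴴ * (A⁻¹ * B * C⁻¹)).trace.re ≤
      Real.log (Matrix.fromBlocks A 0 0 C).det.re
        - Real.log (Matrix.fromBlocks A B Bᴴ C).det.re := by
  have := hA.isUnit.invertible
  have hdet := Matrix.det_fromBlocks₁₁ A B Bᴴ C
  rw [Matrix.invOf_eq_nonsing_inv] at hdet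
  have hM0 := (Matrix.PosDef.fromBlocks₁₁ B C hA).1 hρ.posSemidef
  -- The Schur criterion gives only semidefiniteness; the nonzero block determinant makes it strict.
  have hM : (C - Bᴴ * A⁻¹ * B).PosDef := by
    refine hM0.posDef_iff_isUnit.2 ((Matrix.isUnit_iff_isUnit_det _).2 (isUnit_iff_ne_zero.2 ?_))
    intro h0
    rw [h0, mul_zero] at hdet
    exact hρ.det_pos.ne' hdet
  have h := log_det_le hM hC
  have htr : ((C - Bᴴ * A⁻¹ * B) * C⁻¹).trace
      = Fintype.card n - (Bᴴ * (A⁻¹ * B * C⁻¹)).trace := by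
    rw [Matrix.sub_mul, Matrix.mul_nonsing_inv _ ((Matrix.isUnit_iff_isUnit_det _).1 hC.isUnit),
      Matrix.trace_sub, Matrix.trace_one]
    simp only [Matrix.mul_assoc]
  rw [htr, Complex.sub_re, Complex.natCast_re] at h
  rw [hdet, Matrix.det_fromBlocks_zero₂₁, (det_re_pos hA).2, Complex.re_ofReal_mul,
    Complex.re_ofReal_mul, Real.log_mul (det_re_pos hA).1.ne' (det_re_pos hC).1.ne',
    Real.log_mul (det_re_pos hA).1.ne' (det_re_pos hM).1.ne']
  linarith

theorem trace_mul_bkmIntegrand_le {A : Matrix m m ℂ} {B : Matrix m n ℂ} {C : Matrix n n ℂ}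
    (hA : A.PosDef) (hC : C.PosDef) (hρ : (Matrix.fromBlocks A B Bᴴ C).PosSemidef)
    (hσ : (Matrix.fromBlocks A 0 0 C).PosDef) {r : ℝ} (hr : 0 < r) :
    (Bᴴ * bkmIntegrand A C B r).trace.re ≤
      ∑ i, Real.log (hσ.isHermitian.eigenvalues i + r)
        - ∑ i, Real.log (hρ.isHermitian.eigenvalues i + r) := by
  have h := trace_le_log_det_sub (B := B) (posDef_add_smul_one hA.posSemidef hr)
    (posDef_add_smul_one hC.posSemidef hr)
    (by rw [← fromBlocks_add_smul_one]; exact posDef_add_smul_one hρ hr)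
  rw [← fromBlocks_add_smul_one, ← fromBlocks_add_smul_one, det_add_smul_one hσ.isHermitian,
    det_add_smul_one hρ.isHermitian, Complex.ofReal_re, Complex.ofReal_re,
    Real.log_prod fun i _ => (add_pos (hσ.eigenvalues_pos i) hr).ne',
    Real.log_prod fun i _ => (add_pos_of_nonneg_of_pos (hρ.eigenvalues_nonneg i) hr).ne'] at h
  exact h

/-! ### Convergence of the kernel integral -/

theorem inv_add_smul_one_apply {A : Matrix d d ℂ} (hA : A.PosDef) {r : ℝ} (hr : 0 ≤ r) (i j : d) :
    (A + (r : ℂ) • (1 : Matrix d d ℂ))⁻¹ i j = ∑ k, ((hA.isHermitian.eigenvalues k + r)⁻¹ : ℝ) *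
      ((hA.isHermitian.eigenvectorUnitary : Matrix d d ℂ) i k *
        star ((hA.isHermitian.eigenvectorUnitary : Matrix d d ℂ) j k)) := by
  set U := hA.isHermitian.eigenvectorUnitary with hU
  set D : (d → ℂ) → Matrix d d ℂ := fun f => Unitary.conjStarAlgAut ℂ _ U (Matrix.diagonal f)
    with hD
  have h1 : A + (r : ℂ) • (1 : Matrix d d ℂ)
      = D fun k => ((hA.isHermitian.eigenvalues k + r : ℝ) : ℂ) := by
    have h := hA.isHermitian.spectral_theorem
    have h' : (r : ℂ) • (1 : Matrix d d ℂ) = D fun _ => (r : ℂ) := by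
      simp only [hD, ← Matrix.smul_one_eq_diagonal, map_smul, map_one]
    rw [h']
    nth_rw 1 [h]
    rw [← hU]
    simp only [hD]
    rw [← map_add, Matrix.diagonal_add]
    simp
  have h2 : (A + (r : ℂ) • (1 : Matrix d d ℂ))⁻¹
      = D fun k => (((hA.isHermitian.eigenvalues k + r)⁻¹ : ℝ) : ℂ) := by
    refine Matrix.inv_eq_right_inv ?_
    rw [h1]
    simp only [hD, ← map_mul, Matrix.diagonal_mul_diagonal, ← Complex.ofReal_mul]
    have : ∀ k, (hA.isHermitian.eigenvalues k + r) * (hA.isHermitian.eigenvalues k + r)⁻¹ = 1 :=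
      fun k => mul_inv_cancel₀ (by linarith [hA.eigenvalues_pos k])
    simp only [this, Complex.ofReal_one, Matrix.diagonal_one, map_one]
  rw [h2]
  simp only [hD]
  rw [Unitary.conjStarAlgAut_apply, Matrix.mul_apply]
  simp only [Matrix.mul_diagonal, Matrix.star_apply]
  exact Finset.sum_congr rfl fun k _ => by ring

theorem integrableOn_inv_mul_inv {a c : ℝ} (ha : 0 < a) (hc : 0 < c) :
    IntegrableOn (fun r : ℝ => (a + r)⁻¹ * (c + r)⁻¹) (Ioi 0) := by
  have hm : 0 < min a c := lt_min ha hc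
  -- The dominating function is (min a c + r)⁻².
  refine (integrableOn_add_rpow_Ioi_of_lt (a := -2) (c := 0) (m := min a c) (by norm_num)
    (by linarith)).mono' (by fun_prop) ?_
  refine (ae_restrict_mem measurableSet_Ioi).mono fun r hr => ?_
  have hr : 0 < r := hr
  rw [Real.norm_of_nonneg (by positivity), Real.rpow_neg (by positivity), Real.rpow_two, sq,
    mul_inv]
  have h1 := min_le_left a c
  have h2 := min_le_right a c
  exact mul_le_mul (inv_anti₀ (by positivity) (by linarith))
    (inv_anti₀ (by positivity) (by linarith)) (by positivity) (by positivity)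

theorem integrableOn_bkmIntegrand {A : Matrix m m ℂ} (B : Matrix m n ℂ) {C : Matrix n n ℂ}
    (hA : A.PosDef) (hC : C.PosDef) (i : m) (j : n) :
    IntegrableOn (fun r : ℝ => bkmIntegrand A C B r i j) (Ioi 0) := by
  refine (integrableOn_congr_fun (g := fun r : ℝ => ∑ l, (∑ k,
    (A + (r : ℂ) • (1 : Matrix m m ℂ))⁻¹ i k * B k l) * (C + (r : ℂ) • (1 : Matrix n n ℂ))⁻¹ l j)
    (fun r _ => by simp only [bkmIntegrand, Matrix.mul_apply]) measurableSet_Ioi).2 ?_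
  refine integrable_finsetSum _ fun l _ => ?_
  simp only [Finset.sum_mul]
  refine integrable_finsetSum _ fun k _ => ?_
  refine (integrableOn_congr_fun (fun r (hr : 0 < r) => by
    rw [inv_add_smul_one_apply hA hr.le, inv_add_smul_one_apply hC hr.le]) measurableSet_Ioi).2 ?_
  simp only [Finset.sum_mul, Finset.mul_sum]
  refine integrable_finsetSum _ fun q _ => integrable_finsetSum _ fun p _ => ?_
  -- In the eigenbases of A and C, each entry is a finite combination of (a + r)⁻¹ (c + r)⁻¹ with a,
  -- c > 0.
  have h := ((integrableOn_inv_mul_inv (hA.eigenvalues_pos p)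
    (hC.eigenvalues_pos q)).ofReal (𝕜 := ℂ)).mul_const
    (((hA.isHermitian.eigenvectorUnitary : Matrix m m ℂ) i p *
        star ((hA.isHermitian.eigenvectorUnitary : Matrix m m ℂ) k p)) * B k l *
      ((hC.isHermitian.eigenvectorUnitary : Matrix n n ℂ) l q *
        star ((hC.isHermitian.eigenvectorUnitary : Matrix n n ℂ) j q)))
  refine h.congr (Eventually.of_forall fun r => ?_)
  simp only [RCLike.ofReal_eq_complex_ofReal, Complex.ofReal_mul]
  ring

theorem trace_mul_bkmKernel {A : Matrix m m ℂ} (B : Matrix m n ℂ) {C : Matrix n n ℂ}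
    (hA : A.PosDef) (hC : C.PosDef) :
    IntegrableOn (fun r : ℝ => (Bᴴ * bkmIntegrand A C B r).trace.re) (Ioi 0) ∧
      (Bᴴ * bkmKernel A C B).trace.re
        = ∫ r in Ioi (0 : ℝ), (Bᴴ * bkmIntegrand A C B r).trace.re := by
  have h (i : n) (j : m) :=
    (integrableOn_bkmIntegrand B hA hC j i).const_mul (Bᴴ i j)
  have hint : IntegrableOn (fun r : ℝ => (Bᴴ * bkmIntegrand A C B r).trace) (Ioi 0) := by
    simp only [Matrix.trace, Matrix.diag, Matrix.mul_apply]
    exact integrable_finsetSum _ fun i _ => integrable_finsetSum _ fun j _ => h i j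
  refine ⟨hint.re, ?_⟩
  have hre := integral_re hint
  simp only [RCLike.re_eq_complex_re] at hre
  rw [hre]
  congr 1
  simp only [Matrix.trace, Matrix.diag, Matrix.mul_apply, bkmKernel, Matrix.of_apply]
  rw [integral_finsetSum _ fun i _ => integrable_finsetSum _ fun j _ => h i j]
  refine Finset.sum_congr rfl fun i _ => ?_
  rw [integral_finsetSum _ fun j _ => h i j]
  exact Finset.sum_congr rfl fun j _ => (integral_const_mul _ _).symm

/-! ### Pinching and relative entropy -/

theorem posDef_fromBlocks_zero {A : Matrix m m ℂ} {C : Matrix n n ℂ}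
    (hA : A.PosDef) (hC : C.PosDef) : (Matrix.fromBlocks A 0 0 C).PosDef := by
  have := hA.isUnit.invertible
  have h := (Matrix.PosDef.fromBlocks₁₁ (0 : Matrix m n ℂ) C hA).2
    (by simpa using hC.posSemidef)
  rw [Matrix.conjTranspose_zero] at h
  exact h.posDef_iff_isUnit.2 (Matrix.isUnit_fromBlocks_zero₂₁.2 ⟨hA.isUnit, hC.isUnit⟩)

/-- The pinching is self-dual against every function of the pinched matrix. -/
theorem trace_mul_matLog_fromBlocks (A : Matrix m m ℂ) (B : Matrix m n ℂ) (B' : Matrix n m ℂ)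
    (C : Matrix n n ℂ) :
    (Matrix.fromBlocks A B B' C * matLog (Matrix.fromBlocks A 0 0 C)).trace
      = (Matrix.fromBlocks A 0 0 C * matLog (Matrix.fromBlocks A 0 0 C)).trace := by
  set σ := Matrix.fromBlocks A 0 0 C with hσ
  -- Conjugation by Z flips the sign of off-diagonal blocks but fixes σ, hence log σ, so the
  -- off-diagonal trace equals its own negative.
  set Z : Matrix (m ⊕ n) (m ⊕ n) ℂ := Matrix.fromBlocks 1 0 0 (-1) with hZ
  have hZZ : Z * Z = 1 := by simp [hZ, Matrix.fromBlocks_multiply]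
  have hc : Commute σ Z := by
    simp [hZ, hσ, Commute, SemiconjBy, Matrix.fromBlocks_multiply]
  have hl : Commute (matLog σ) Z := hc.cfc_real _
  have hX : Z * Matrix.fromBlocks 0 B B' 0 * Z = - Matrix.fromBlocks 0 B B' 0 := by
    simp [hZ, Matrix.fromBlocks_multiply, Matrix.fromBlocks_neg]
  have hsum : Matrix.fromBlocks A B B' C = σ + Matrix.fromBlocks 0 B B' 0 := by
    simp [hσ, Matrix.fromBlocks_add]
  have h0 : (Matrix.fromBlocks 0 B B' 0 * matLog σ).trace
      = -(Matrix.fromBlocks 0 B B' 0 * matLog σ).trace := by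
    calc (Matrix.fromBlocks 0 B B' 0 * matLog σ).trace
        = (Matrix.fromBlocks 0 B B' 0 * (Z * matLog σ * Z)).trace := by
          rw [← hl.eq, Matrix.mul_assoc, hZZ, Matrix.mul_one]
      _ = (Z * Matrix.fromBlocks 0 B B' 0 * Z * matLog σ).trace := by
          rw [← Matrix.mul_assoc, Matrix.trace_mul_comm]
          simp only [Matrix.mul_assoc]
      _ = _ := by rw [hX, Matrix.neg_mul, Matrix.trace_neg]
  rw [hsum, Matrix.add_mul, Matrix.trace_add, self_eq_neg.1 h0, add_zero]

end BlockEntropy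

open BlockEntropy in
theorem theorem3p2 {m n : Type*} [Fintype m] [Fintype n] [DecidableEq m] [DecidableEq n]
    (A : Matrix m m ℂ) (B : Matrix m n ℂ) (C : Matrix n n ℂ)
    (hρ : BlockEntropy.IsDensityMatrix (Matrix.fromBlocks A B Bᴴ C))
    (hA : A.PosDef) (hC : C.PosDef) :
    (∀ i j, MeasureTheory.IntegrableOn
      (fun r : ℝ => BlockEntropy.bkmIntegrand A C B r i j) (Set.Ioi 0)) ∧
    (((Bᴴ * BlockEntropy.bkmKernel A C B).trace.re : ℝ) : EReal) ≤
      BlockEntropy.relEntropy (Matrix.fromBlocks A B Bᴴ C)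
        (BlockEntropy.pinching (Matrix.fromBlocks A B Bᴴ C)) := by
  refine ⟨integrableOn_bkmIntegrand B hA hC, ?_⟩
  have hσ := posDef_fromBlocks_zero hA hC
  have hρ := hρ.1
  rw [pinching, Matrix.toBlocks_fromBlocks₁₁, Matrix.toBlocks_fromBlocks₂₂, relEntropy, if_pos,
    EReal.coe_le_coe_iff]
  · obtain ⟨hint, heq⟩ := trace_mul_bkmKernel B hA hC
    have htr : ∑ i, hσ.isHermitian.eigenvalues i = ∑ i, hρ.isHermitian.eigenvalues i := by
      have h : (Matrix.fromBlocks A 0 0 C).trace = (Matrix.fromBlocks A B Bᴴ C).trace := by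
        simp [Matrix.trace]
      rw [hσ.isHermitian.trace_eq_sum_eigenvalues, hρ.isHermitian.trace_eq_sum_eigenvalues] at h
      exact_mod_cast h
    rw [heq, Matrix.mul_sub, Matrix.trace_sub, trace_mul_matLog_fromBlocks,
      trace_mul_matLog hσ.isHermitian, trace_mul_matLog hρ.isHermitian, ← Complex.ofReal_sub,
      Complex.ofReal_re]
    exact integral_le_sum_mul_log_sub (fun i => (hσ.eigenvalues_pos i).le) hρ.eigenvalues_nonneg
      htr hint fun r hr => trace_mul_bkmIntegrand_le hA hC hρ hσ hr
  -- σ is invertible, so the kernel condition holds trivially.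
  · intro v hv
    have hv0 : v = 0 := Matrix.mulVec_injective_of_isUnit hσ.isUnit (by simpa using hv)
    rw [hv0, Matrix.mulVec_zero]
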